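/- Consider elections with three candidates in which each voter casts one of nine ballots: one of the six complete rankings of the candidates, or one of the three ballots naming a first choice only (a ballot ranking two candidates is identified with the complete ranking that puts the remaining candidate third). A profile records how many voters cast each ballot. Under instant runoff voting (IRV), a candidate with more than half of the remaining first-place votes wins; if there is none, the candidate with the fewest first-place votes is eliminated, each ballot then counts for its highest-ranked remaining candidate (a ballot with no remaining candidate is exhausted and is disregarded), and the process repeats. If a candidate has to be eliminated and there is a tie for the fewest first-place votes, the election has no IRV winner. The plurality winner is the candidate with strictly more first-place votes than each other candidate, if there is one; a majority candidate is one with more than half of the first-place votes. An election demonstrates a *negative participation paradox* if some candidate other than $A$ is the IRV winner and there is a collection of identical ballots, each ranking $A$ last (third), such that $A$ is the IRV winner after these ballots are added. Under the impartial anonymous culture (IAC) model with $V$ voters, all profiles, i.e. all vectors $(n_1,\dots,n_9)$ of non-negative integers with $n_1+\dots+n_9=V$, are equally likely. Then, as $V\to\infty$: 1. the probability that the election demonstrates a negative participation paradox tends to $\frac{169}{2304}$; 2. the conditional probability that it demonstrates a negative participation paradox, given that there is no majority candidate, tends to $\frac{169}{1305}$; 3. the conditional probability that it demonstrates a negative participation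 paradox, given that the IRV winner is not the plurality winner (both existing), tends to $\frac{117}{187}$. -/

import Mathlib

open Filter Topology

/-- The three candidates. -/
abbrev Candidate : Type := Fin 3

/-- A ballot in a three-candidate election with partial preferences: a first choice, together with
either nothing more (a ballot ranking only one candidate) or a second choice different from the
first. A ballot with two choices is identified with the complete ranking obtained by putting the
remaining candidate third, so there are nine ballots. -/
abbrev Ballot : Type := {b : Candidate × Option Candidate // b.2 ≠ some b.1}

/-- The candidates ranked on a ballot, in order of preference. -/
def Ballot.ranking (b : Ballot) : List Candidate :=
  match b.1.2 with
  | none => [b.1.1]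
  | some s => b.1.1 :: s :: (List.finRange 3).filter fun c => c ≠ b.1.1 ∧ c ≠ s

/-- Candidate `A` is ranked last, i.e. third, on the ballot `b`. -/
def Ballot.RanksLast (b : Ballot) (A : Candidate) : Prop :=
  ∃ x y : Candidate, b.ranking = [x, y, A]

/-- The most preferred candidate on the ballot `b` among the remaining candidates `S`; `none` if the
ballot is exhausted, i.e. ranks no remaining candidate. -/
def Ballot.top (S : Finset Candidate) (b : Ballot) : Option Candidate :=
  b.ranking.find? fun c => c ∈ S

/-- A preference profile: how many voters cast each ballot. -/
abbrev Profile : Type := Ballot → ℕ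

namespace Profile

/-- The number of first-place votes of `c` when the candidates in `S` remain. -/
def votes (P : Profile) (S : Finset Candidate) (c : Candidate) : ℕ :=
  ∑ b : Ballot, if b.top S = some c then P b else 0

/-- `c` has a (strict) majority of the remaining first-place votes when the candidates in `S`
remain. -/
def HasMajority (P : Profile) (S : Finset Candidate) (c : Candidate) : Prop :=
  c ∈ S ∧ ∑ d ∈ S, P.votes S d < 2 * P.votes S c

/-- `P.IRVFrom S X`: if the candidates in `S` remain, the instant runoff elects `X`. A candidate with
a majority of the remaining first-place votes is elected; if there is none, the candidate with the
fewest first-place votes is eliminated and the process is repeated. If there is a tie for the fewest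
first-place votes, the process does not produce a winner. -/
inductive IRVFrom (P : Profile) : Finset Candidate → Candidate → Prop
  | majority {S : Finset Candidate} {X : Candidate} :
      P.HasMajority S X → IRVFrom P S X
  | eliminate {S : Finset Candidate} {X L : Candidate} :
      (∀ c, ¬ P.HasMajority S c) →
      L ∈ S → (∀ c ∈ S, c ≠ L → P.votes S L < P.votes S c) →
      IRVFrom P (S.erase L) X → IRVFrom P S X

/-- `X` is the winner of the election under instant runoff voting. -/
def IRVWinner (P : Profile) (X : Candidate) : Prop :=
  P.IRVFrom Finset.univ X

/-- `X` is the plurality winner: it has more first-place votes than each other candidate. -/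
def PluralityWinner (P : Profile) (X : Candidate) : Prop :=
  ∀ c, c ≠ X → P.votes Finset.univ c < P.votes Finset.univ X

/-- The profile obtained from `P` by adding `z` copies of the ballot `b`. -/
def addBallots (P : Profile) (b : Ballot) (z : ℕ) : Profile :=
  P + Pi.single b z

/-- The election demonstrates a negative participation paradox: some losing candidate `A` becomes the
winner when a number of identical ballots on which `A` is ranked last is added. -/
def NegativeParticipationParadox (P : Profile) : Prop :=
  ∃ A : Candidate, (∃ B, B ≠ A ∧ P.IRVWinner B) ∧
    ∃ (b : Ballot) (z : ℕ), b.RanksLast A ∧ (P.addBallots b z).IRVWinner A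

/-- No candidate has a majority of the first-place votes. -/
def NoMajorityCandidate (P : Profile) : Prop :=
  ∀ c, ¬ P.HasMajority Finset.univ c

/-- The IRV winner is not the plurality winner. -/
def WinnersDiffer (P : Profile) : Prop :=
  ∃ A B : Candidate, P.PluralityWinner A ∧ P.IRVWinner B ∧ B ≠ A

end Profile

/-- The profiles with exactly `V` voters. -/
def profiles (V : ℕ) : Finset Profile :=
  Finset.piAntidiag Finset.univ V

open Classical in
/-- The probability of the event `E` under the impartial anonymous culture model with `V` voters:
all profiles with `V` voters are equally likely. -/
noncomputable def iacProb (V : ℕ) (E : Profile → Prop) : ℝ :=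
  (((profiles V).filter E).card : ℝ) / ((profiles V).card : ℝ)

/-- The conditional probability of `E` given `F` under the impartial anonymous culture model with `V`
voters (with value `0` if `F` has probability `0`). -/
noncomputable def iacCondProb (V : ℕ) (E F : Profile → Prop) : ℝ :=
  iacProb V (fun P => E P ∧ F P) / iacProb V F

/-! Name the candidates A, B, C through a permutation `σ`, with first-place totals a, b, c, and
write CBA etc. for the number of voters with that ranking. Ballots ranking A last never improve A's
pairwise margins or A's own total, so they can make A win only by changing who is eliminated. If B
wins at first and A afterwards, then C was eliminated at first, B is eliminated afterwards, and the
added ballots are CBA. The cheapest choice lifts C to b + 1 votes, just above B, and A must still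
beat C. The paradox thus means c < b < a, a + CAB < b + CBA and b + BCA + 1 < a + BAC
(`negativeParticipationParadox_iff`). The first two conditions say exactly that the plurality winner
A loses to the runner-up B (`winnersDiffer_iff`). They determine `σ`, so the events for the six
permutations are disjoint and equally large.

For fixed (a, b, c) the conditions constrain the row of each first choice separately, so the count
is a sum over (a, b, c) of products of three row counts (`card_filter_table`). A row with sum n has
(n + 2 choose 2) ~ n²/2 possibilities, and about (n - d)²/4 if one entry must exceed another by d
(`rowCount_add`). The summand is therefore asymptotically homogeneous of degree 6 over a planar
lattice region, and the sum divided by V⁸ tends to the integral of its leading part over a polygon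
(`tendsto_sum_div_pow`). The total number of profiles is ~ V⁸/8!.

Multiplying by 8!, and by 6 for the events split over the permutations, gives 169/2304 for the
paradox, 2431/20736 for differing winners and 145/256 for no majority. The paradox implies each of
the two conditioning events, so the conditional limits are quotients. -/

/-! ### Ballots as a 3 × 3 table -/

/-- The candidates other than `i`, listed at the indices `1` and `2`; the index `0` is a dummy. -/
def secondChoice : Fin 3 → Fin 3 → Fin 3 :=
  ![![0, 1, 2], ![1, 2, 0], ![2, 1, 0]]

/-- The ballots, arranged in a table: with the candidates named by `σ`, the row is the first choice;
the column is `0` if there is no second choice. -/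
def ballotOf (σ : Equiv.Perm Candidate) (i j : Fin 3) : Ballot :=
  ⟨(σ i, if j = 0 then none else some (σ (secondChoice i j))), by
    have h : ∀ i j : Fin 3, j ≠ 0 → secondChoice i j ≠ i := by decide
    by_cases hj : j = 0
    · simp [hj]
    · simpa [hj] using h i j hj⟩

theorem ballotOf_bijective (σ : Equiv.Perm Candidate) :
    Function.Bijective fun ij : Fin 3 × Fin 3 => ballotOf σ ij.1 ij.2 := by
  revert σ
  decide +kernel

/-- The table of ballots as an equivalence. -/
noncomputable def ballotEquiv (σ : Equiv.Perm Candidate) : Fin 3 × Fin 3 ≃ Ballot :=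
  Equiv.ofBijective _ (ballotOf_bijective σ)

theorem ballotOf_top_univ (σ : Equiv.Perm Candidate) (a j i : Fin 3) :
    (ballotOf σ a j).top Finset.univ = some (σ i) ↔ a = i := by
  revert σ a j i
  decide +kernel

theorem ballotOf_top_erase (σ : Equiv.Perm Candidate) (a j k i : Fin 3) (hik : i ≠ k) :
    (ballotOf σ a j).top (Finset.univ.erase (σ k)) = some (σ i) ↔
      a = i ∨ a = k ∧ j ≠ 0 ∧ secondChoice k j = i := by
  revert σ a j k i
  decide +kernel

/-- The entries of `secondChoice` are ordered so that, with candidates A, B, C, column 1 of rows 1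
and 2 holds BCA and CBA, and column 2 holds BAC and CAB. -/
theorem ballotOf_ranksLast (σ : Equiv.Perm Candidate) (i j : Fin 3) :
    (ballotOf σ i j).RanksLast (σ 0) ↔ (i = 1 ∧ j = 1) ∨ (i = 2 ∧ j = 1) := by
  unfold Ballot.RanksLast
  revert σ i j
  decide +kernel

/-! ### Instant runoff and the paradox as linear inequalities -/

namespace Profile

/-- The profile as a table, with the candidates named by `σ`. -/
def table (σ : Equiv.Perm Candidate) (P : Profile) (i j : Fin 3) : ℕ := P (ballotOf σ i j)

/-- The first-place votes, with the candidates named by `σ`. -/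
def firsts (σ : Equiv.Perm Candidate) (P : Profile) (i : Fin 3) : ℕ := ∑ j, P.table σ i j

theorem firsts_eq (σ : Equiv.Perm Candidate) (P : Profile) (i : Fin 3) :
    P.firsts σ i = P.table σ i 0 + P.table σ i 1 + P.table σ i 2 := by
  simp [firsts, Fin.sum_univ_three]

theorem sum_eq_sum_table (σ : Equiv.Perm Candidate) (f : Ballot → ℕ) :
    ∑ b, f b = ∑ i, ∑ j, f (ballotOf σ i j) := by
  rw [← (ballotEquiv σ).sum_comp f, Fintype.sum_prod_type]
  rfl

theorem sum_firsts (σ : Equiv.Perm Candidate) (P : Profile) :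
    ∑ i, P.firsts σ i = ∑ b, P b := by
  rw [sum_eq_sum_table σ]
  rfl

theorem votes_univ (σ : Equiv.Perm Candidate) (P : Profile) (i : Fin 3) :
    P.votes Finset.univ (σ i) = P.firsts σ i := by
  rw [votes, sum_eq_sum_table σ]
  simp_rw [ballotOf_top_univ]
  rw [Finset.sum_eq_single i (by intro b _ hb; simp [hb]) (by simp)]
  simp [firsts, table]

theorem firsts_eq_votes (σ : Equiv.Perm Candidate) (P : Profile) (i : Fin 3) :
    P.firsts σ i = P.votes Finset.univ (σ i) :=
  (votes_univ σ P i).symm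

theorem votes_erase (σ : Equiv.Perm Candidate) (P : Profile) {k i j : Fin 3} (hik : i ≠ k)
    (hj : j ≠ 0) (hji : secondChoice k j = i) :
    P.votes (Finset.univ.erase (σ k)) (σ i) = P.firsts σ i + P.table σ k j := by
  have huniq : ∀ k i j j' : Fin 3, j ≠ 0 → secondChoice k j = i →
      ((j' ≠ 0 ∧ secondChoice k j' = i) ↔ j' = j) := by decide
  rw [votes, sum_eq_sum_table σ]
  simp_rw [ballotOf_top_erase σ _ _ k i hik, huniq k i j _ hj hji]
  have h : ∀ a b : Fin 3, (if a = i ∨ a = k ∧ b = j then P (ballotOf σ a b) else 0) =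
      (if a = i then P.table σ a b else 0) +
        (if a = k then if b = j then P.table σ a b else 0 else 0) := by
    intro a b
    by_cases h1 : a = i
    · subst h1
      simp [hik, table]
    · by_cases h2 : a = k <;> simp [h1, h2, table, hik.symm]
  simp_rw [h, Finset.sum_add_distrib]
  congr 1
  · rw [Finset.sum_eq_single i (by intro b _ hb; simp [hb]) (by simp)]
    simp [firsts]
  · rw [Finset.sum_eq_single k (by intro b _ hb; simp [hb]) (by simp)]
    simp

theorem hasMajority_univ (σ : Equiv.Perm Candidate) (P : Profile) (i : Fin 3) :
    P.HasMajority Finset.univ (σ i) ↔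
      P.firsts σ 0 + P.firsts σ 1 + P.firsts σ 2 < 2 * P.firsts σ i := by
  rw [HasMajority, ← Equiv.sum_comp σ]
  simp [votes_univ, Fin.sum_univ_three]

theorem forall_not_hasMajority_univ (σ : Equiv.Perm Candidate) (P : Profile) :
    (∀ c, ¬ P.HasMajority Finset.univ c) ↔
      (P.firsts σ 0 ≤ P.firsts σ 1 + P.firsts σ 2 ∧ P.firsts σ 1 ≤ P.firsts σ 0 + P.firsts σ 2 ∧
        P.firsts σ 2 ≤ P.firsts σ 0 + P.firsts σ 1) := by
  rw [← σ.forall_congr_right]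
  simp only [hasMajority_univ, Fin.forall_fin_succ, IsEmpty.forall_iff]
  simp
  omega

theorem HasMajority.unique {P : Profile} {S : Finset Candidate} {X Y : Candidate}
    (hX : P.HasMajority S X) (hY : P.HasMajority S Y) : X = Y := by
  by_contra h
  have h1 : P.votes S X + P.votes S Y ≤ ∑ d ∈ S, P.votes S d := by
    rw [← Finset.sum_pair h]
    exact Finset.sum_le_sum_of_subset (by
      intro d hd
      rcases Finset.mem_insert.1 hd with rfl | hd
      · exact hX.1
      · rw [Finset.mem_singleton.1 hd]
        exact hY.1)
  have h2 := hX.2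
  have h3 := hY.2
  omega

theorem not_irvFrom_empty (P : Profile) (X : Candidate) : ¬ P.IRVFrom ∅ X := by
  intro h
  cases h with
  | majority h => simpa using h.1
  | eliminate _ h => simp at h

theorem not_irvFrom_singleton_of_ne (P : Profile) {X Y : Candidate} (hne : X ≠ Y) :
    ¬ P.IRVFrom {Y} X := by
  intro h
  cases h with
  | majority h => exact hne (by simpa using h.1)
  | eliminate _ hL _ h =>
    rw [Finset.mem_singleton.1 hL] at h
    exact not_irvFrom_empty P X (by simpa using h)

/-- With two candidates left, having a majority and having strictly more votes are the same; a tie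
elects nobody. -/
theorem irvFrom_pair (P : Profile) {X Y : Candidate} (hne : X ≠ Y) :
    P.IRVFrom {X, Y} X ↔ P.votes {X, Y} Y < P.votes {X, Y} X := by
  have hsum : ∑ d ∈ ({X, Y} : Finset Candidate), P.votes {X, Y} d =
      P.votes {X, Y} X + P.votes {X, Y} Y := Finset.sum_pair hne
  constructor
  · intro h
    cases h with
    | majority h =>
      have := h.2
      omega
    | @eliminate _ _ K hno hL hlt h =>
      have hK : K = X ∨ K = Y := by simpa using hL
      rcases hK with rfl | rfl
      · have : ({K, Y} : Finset Candidate).erase K = {Y} := by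
          ext d
          simp only [Finset.mem_erase, Finset.mem_insert, Finset.mem_singleton]
          constructor
          · tauto
          · rintro rfl
            exact ⟨hne.symm, Or.inr rfl⟩
        rw [this] at h
        exact absurd h (not_irvFrom_singleton_of_ne P hne)
      · exact hlt X (by simp) hne
  · intro h
    exact IRVFrom.majority ⟨by simp, by omega⟩

theorem erase_eq_pair (σ : Equiv.Perm Candidate) {i j k : Fin 3} (hij : i ≠ j) (hik : i ≠ k)
    (hjk : j ≠ k) : Finset.univ.erase (σ k) = {σ i, σ j} := by
  revert σ i j k
  decide +kernel

theorem irvWinner_iff (σ : Equiv.Perm Candidate) (P : Profile) {i j k : Fin 3} (hij : i ≠ j)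
    (hik : i ≠ k) (hjk : j ≠ k) :
    P.IRVWinner (σ i) ↔ P.HasMajority Finset.univ (σ i) ∨
      (∀ c, ¬ P.HasMajority Finset.univ c) ∧
        ((P.firsts σ k < P.firsts σ i ∧ P.firsts σ k < P.firsts σ j ∧
          P.votes (Finset.univ.erase (σ k)) (σ j) < P.votes (Finset.univ.erase (σ k)) (σ i)) ∨
        (P.firsts σ j < P.firsts σ i ∧ P.firsts σ j < P.firsts σ k ∧
          P.votes (Finset.univ.erase (σ j)) (σ k) < P.votes (Finset.univ.erase (σ j)) (σ i))) := by
  have hex : ∀ i j k l : Fin 3, i ≠ j → i ≠ k → j ≠ k → l = i ∨ l = j ∨ l = k := by decide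
  have hej := erase_eq_pair σ hik hij hjk.symm
  have hek := erase_eq_pair σ hij hik hjk
  have hei := erase_eq_pair σ hjk hij.symm hik.symm
  constructor
  · intro h
    cases h with
    | majority h => exact Or.inl h
    | @eliminate _ _ K hno hL hlt h =>
      refine Or.inr ⟨hno, ?_⟩
      obtain ⟨l, rfl⟩ := σ.surjective K
      simp only [firsts_eq_votes]
      rcases hex i j k l hij hik hjk with rfl | rfl | rfl
      · rw [hei] at h
        exfalso
        cases h with
        | majority h =>
          have := h.1
          simp [hij, hik] at this
        | @eliminate _ _ K hno hL hlt h =>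
          have hK : K = σ j ∨ K = σ k := by simpa using hL
          rcases hK with rfl | rfl
          · have : ({σ j, σ k} : Finset Candidate).erase (σ j) = {σ k} := by
              ext d
              simp only [Finset.mem_erase, Finset.mem_insert, Finset.mem_singleton]
              have : σ k ≠ σ j := by simpa using hjk.symm
              constructor
              · tauto
              · rintro rfl
                exact ⟨this, Or.inr rfl⟩
            rw [this] at h
            exact not_irvFrom_singleton_of_ne P (by simpa using hik) h
          · have : ({σ j, σ k} : Finset Candidate).erase (σ k) = {σ j} := by
              ext d
              simp only [Finset.mem_erase, Finset.mem_insert, Finset.mem_singleton]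
              have : σ j ≠ σ k := by simpa using hjk
              constructor
              · tauto
              · rintro rfl
                exact ⟨this, Or.inl rfl⟩
            rw [this] at h
            exact not_irvFrom_singleton_of_ne P (by simpa using hij) h
      · right
        refine ⟨hlt _ (by simp) (by simpa using hij), hlt _ (by simp) (by simpa using hjk.symm), ?_⟩
        rw [hej] at h ⊢
        exact (irvFrom_pair P (by simpa using hik)).1 h
      · left
        refine ⟨hlt _ (by simp) (by simpa using hik), hlt _ (by simp) (by simpa using hjk), ?_⟩
        rw [hek] at h ⊢
        exact (irvFrom_pair P (by simpa using hij)).1 h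
  · simp only [firsts_eq_votes]
    rintro (h | ⟨hno, ⟨h1, h2, h3⟩ | ⟨h1, h2, h3⟩⟩)
    · exact IRVFrom.majority h
    · refine IRVFrom.eliminate hno (Finset.mem_univ (σ k)) ?_ ?_
      · intro c _ hc
        obtain ⟨l, rfl⟩ := σ.surjective c
        rcases hex i j k l hij hik hjk with rfl | rfl | rfl
        · exact h1
        · exact h2
        · exact absurd rfl hc
      · rw [hek] at h3 ⊢
        exact (irvFrom_pair P (by simpa using hij)).2 h3
    · refine IRVFrom.eliminate hno (Finset.mem_univ (σ j)) ?_ ?_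
      · intro c _ hc
        obtain ⟨l, rfl⟩ := σ.surjective c
        rcases hex i j k l hij hik hjk with rfl | rfl | rfl
        · exact h1
        · exact absurd rfl hc
        · exact h2
      · rw [hej] at h3 ⊢
        exact (irvFrom_pair P (by simpa using hik)).2 h3

theorem irvWinner_zero (σ : Equiv.Perm Candidate) (P : Profile) :
    P.IRVWinner (σ 0) ↔ P.firsts σ 1 + P.firsts σ 2 < P.firsts σ 0 ∨
      (P.firsts σ 0 ≤ P.firsts σ 1 + P.firsts σ 2 ∧ P.firsts σ 1 ≤ P.firsts σ 0 + P.firsts σ 2 ∧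
        P.firsts σ 2 ≤ P.firsts σ 0 + P.firsts σ 1) ∧
      ((P.firsts σ 2 < P.firsts σ 0 ∧ P.firsts σ 2 < P.firsts σ 1 ∧
        P.firsts σ 1 + P.table σ 2 1 < P.firsts σ 0 + P.table σ 2 2) ∨
      (P.firsts σ 1 < P.firsts σ 0 ∧ P.firsts σ 1 < P.firsts σ 2 ∧
        P.firsts σ 2 + P.table σ 1 1 < P.firsts σ 0 + P.table σ 1 2)) := by
  rw [irvWinner_iff σ P (i := 0) (j := 1) (k := 2) (by decide) (by decide) (by decide),
    forall_not_hasMajority_univ σ, hasMajority_univ,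
    votes_erase σ P (k := 2) (i := 1) (j := 1) (by decide) (by decide) (by decide),
    votes_erase σ P (k := 2) (i := 0) (j := 2) (by decide) (by decide) (by decide),
    votes_erase σ P (k := 1) (i := 2) (j := 1) (by decide) (by decide) (by decide),
    votes_erase σ P (k := 1) (i := 0) (j := 2) (by decide) (by decide) (by decide)]
  omega

theorem irvWinner_one (σ : Equiv.Perm Candidate) (P : Profile) :
    P.IRVWinner (σ 1) ↔ P.firsts σ 0 + P.firsts σ 2 < P.firsts σ 1 ∨
      (P.firsts σ 0 ≤ P.firsts σ 1 + P.firsts σ 2 ∧ P.firsts σ 1 ≤ P.firsts σ 0 + P.firsts σ 2 ∧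
        P.firsts σ 2 ≤ P.firsts σ 0 + P.firsts σ 1) ∧
      ((P.firsts σ 2 < P.firsts σ 1 ∧ P.firsts σ 2 < P.firsts σ 0 ∧
        P.firsts σ 0 + P.table σ 2 2 < P.firsts σ 1 + P.table σ 2 1) ∨
      (P.firsts σ 0 < P.firsts σ 1 ∧ P.firsts σ 0 < P.firsts σ 2 ∧
        P.firsts σ 2 + P.table σ 0 2 < P.firsts σ 1 + P.table σ 0 1)) := by
  rw [irvWinner_iff σ P (i := 1) (j := 0) (k := 2) (by decide) (by decide) (by decide),
    forall_not_hasMajority_univ σ, hasMajority_univ,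
    votes_erase σ P (k := 2) (i := 1) (j := 1) (by decide) (by decide) (by decide),
    votes_erase σ P (k := 2) (i := 0) (j := 2) (by decide) (by decide) (by decide),
    votes_erase σ P (k := 0) (i := 2) (j := 2) (by decide) (by decide) (by decide),
    votes_erase σ P (k := 0) (i := 1) (j := 1) (by decide) (by decide) (by decide)]
  omega

theorem exists_perm {A B : Candidate} (h : B ≠ A) :
    ∃ σ : Equiv.Perm Candidate, σ 0 = A ∧ σ 1 = B := by
  revert A B
  decide +kernel

theorem table_addBallots (σ : Equiv.Perm Candidate) (P : Profile) (a b : Fin 3) (z : ℕ)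
    (i j : Fin 3) : (P.addBallots (ballotOf σ a b) z).table σ i j =
      P.table σ i j + if i = a ∧ j = b then z else 0 := by
  have h : ballotOf σ i j = ballotOf σ a b ↔ i = a ∧ j = b := by
    have := (ballotOf_bijective σ).1.eq_iff (a := (i, j)) (b := (a, b))
    simpa using this
  simp [table, addBallots, Pi.single_apply, h]

/-- With the candidates named `A, B, C` by `σ`: `A` is the plurality winner, `C` is eliminated,
and `B` beats `A` in the runoff. -/
def RunnerUpWins (σ : Equiv.Perm Candidate) (P : Profile) : Prop :=
  P.firsts σ 2 < P.firsts σ 1 ∧ P.firsts σ 1 < P.firsts σ 0 ∧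
    P.firsts σ 0 + P.table σ 2 2 < P.firsts σ 1 + P.table σ 2 1

/-- A majority candidate would win both contests, and the plurality winner is never eliminated
first. Hence the third candidate is eliminated and the runoff is between A and B. -/
theorem winnersDiffer_iff (P : Profile) : P.WinnersDiffer ↔ ∃ σ, P.RunnerUpWins σ := by
  constructor
  · rintro ⟨A, B, hA, hB, hne⟩
    obtain ⟨σ, rfl, rfl⟩ := exists_perm hne
    refine ⟨σ, ?_⟩
    have h1 := hA (σ 1) hne
    have h2 := hA (σ 2) (by simp)
    rw [votes_univ, votes_univ] at h1 h2
    rw [irvWinner_one] at hB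
    unfold RunnerUpWins
    omega
  · rintro ⟨σ, h1, h2, h3⟩
    refine ⟨σ 0, σ 1, ?_, ?_, by simp⟩
    · intro c hc
      obtain ⟨l, rfl⟩ := σ.surjective c
      rw [votes_univ, votes_univ]
      have := (by decide : ∀ l : Fin 3, l = 0 ∨ l = 1 ∨ l = 2) l
      rcases this with rfl | rfl | rfl
      · exact absurd rfl hc
      · exact h2
      · exact h1.trans h2
    · rw [irvWinner_one]
      -- This yields CBA ≤ c, so the runoff inequality forces a < b + c and A has no majority.
      have := P.firsts_eq σ 2
      omega

theorem negativeParticipationParadox_iff (P : Profile) : P.NegativeParticipationParadox ↔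
    ∃ σ, P.RunnerUpWins σ ∧ P.firsts σ 1 + P.table σ 1 1 + 1 < P.firsts σ 0 + P.table σ 1 2 := by
  constructor
  · rintro ⟨A, ⟨B, hne, hB⟩, b, z, hb, hA⟩
    obtain ⟨σ, rfl, rfl⟩ := exists_perm hne
    refine ⟨σ, ?_⟩
    obtain ⟨⟨a, c⟩, rfl⟩ := (ballotOf_bijective σ).2 b
    dsimp only at hb hA
    rw [ballotOf_ranksLast] at hb
    have h0 := P.firsts_eq σ 0
    have h1 := P.firsts_eq σ 1
    have h2 := P.firsts_eq σ 2
    rw [irvWinner_one] at hB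
    unfold RunnerUpWins
    rcases hb with ⟨rfl, rfl⟩ | ⟨rfl, rfl⟩
    -- The added ballots are BCA or CBA. Ballots BCA also raise B's total and so cannot cause B's
    -- elimination: that case is contradictory. For CBA, the new elimination of B gives b < c + z,
    -- and A beating C then gives the last inequality, since b + 1 ≤ c + z.
    all_goals
      rw [irvWinner_zero] at hA
      simp [firsts_eq _ (addBallots _ _ _), table_addBallots] at hA
      omega
  · rintro ⟨σ, ⟨h1, h2, h3⟩, h4⟩
    have e0 := P.firsts_eq σ 0
    have e1 := P.firsts_eq σ 1
    have e2 := P.firsts_eq σ 2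
    -- The fewest CBA ballots that put C strictly above B, a tie for last place giving no winner; C
    -- then has exactly b + 1 first-place votes.
    refine ⟨σ 0, ⟨σ 1, by simp, ?_⟩, ballotOf σ 2 1, P.firsts σ 1 + 1 - P.firsts σ 2, ?_, ?_⟩
    · rw [irvWinner_one]
      omega
    · rw [ballotOf_ranksLast]
      simp
    · rw [irvWinner_zero]
      simp [firsts_eq _ (addBallots _ _ _), table_addBallots]
      omega

theorem noMajorityCandidate_iff (P : Profile) : P.NoMajorityCandidate ↔
    ∀ i, 2 * P.firsts 1 i ≤ ∑ b, P b := by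
  rw [NoMajorityCandidate, forall_not_hasMajority_univ 1, ← sum_firsts 1]
  simp only [Fin.forall_fin_succ, IsEmpty.forall_iff, Fin.sum_univ_three]
  simp
  omega

theorem NegativeParticipationParadox.winnersDiffer {P : Profile}
    (h : P.NegativeParticipationParadox) : P.WinnersDiffer := by
  obtain ⟨σ, hσ, -⟩ := (negativeParticipationParadox_iff P).1 h
  exact (winnersDiffer_iff P).2 ⟨σ, hσ⟩

theorem NegativeParticipationParadox.noMajorityCandidate {P : Profile}
    (h : P.NegativeParticipationParadox) : P.NoMajorityCandidate := by
  obtain ⟨σ, ⟨h1, h2, h3⟩, -⟩ := (negativeParticipationParadox_iff P).1 h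
  have := P.firsts_eq σ 2
  rw [NoMajorityCandidate, forall_not_hasMajority_univ σ]
  omega

/-- The permutation lists the candidates in strictly decreasing order of first-place votes, and only
one permutation does so. -/
theorem RunnerUpWins.unique {P : Profile} {σ τ : Equiv.Perm Candidate}
    (hσ : P.RunnerUpWins σ) (hτ : P.RunnerUpWins τ) : σ = τ := by
  have key : ∀ ρ : Equiv.Perm Candidate, P.RunnerUpWins ρ →
      StrictAnti fun i : Fin 3 => P.votes Finset.univ (ρ i) := by
    rintro ρ ⟨h1, h2, -⟩
    rw [Fin.strictAnti_iff_succ_lt]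
    intro i
    simp only [votes_univ]
    fin_cases i
    · exact h2
    · exact h1
  have h1 := key σ hσ
  have h2 := key τ hτ
  have h3 : StrictMono (σ⁻¹ * τ : Equiv.Perm Candidate) := by
    intro i j hij
    have := h2 hij
    rw [← h1.lt_iff_gt]
    simpa using this
  have h4 : ∀ ρ : Equiv.Perm (Fin 3), StrictMono ρ → ρ = 1 := by
    unfold StrictMono
    decide +kernel
  have := h4 _ h3
  rwa [inv_mul_eq_one] at this

end Profile

/-! ### Exact counts of profiles -/

theorem card_piAntidiag_univ (ι : Type*) [Fintype ι] [DecidableEq ι] (n : ℕ) :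
    (Finset.piAntidiag (Finset.univ : Finset ι) n).card = (Fintype.card ι + n - 1).choose n := by
  rw [← Finset.map_sym_eq_piAntidiag, Finset.card_map, Finset.sym_univ, Finset.card_univ,
    Sym.card_sym_eq_choose]

theorem card_piAntidiag_fin_three (n : ℕ) :
    (Finset.piAntidiag (Finset.univ : Finset (Fin 3)) n).card = (n + 2).choose 2 := by
  rw [card_piAntidiag_univ, Fintype.card_fin, show 3 + n - 1 = n + 2 by omega,
    ← Nat.choose_symm_add, Nat.add_comm]

theorem card_profiles (V : ℕ) : (profiles V).card = (V + 8).choose 8 := by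
  have h : Fintype.card Ballot = 9 := by decide
  rw [profiles, card_piAntidiag_univ, h, show 9 + V - 1 = V + 8 by omega, ← Nat.choose_symm_add,
    Nat.add_comm]

/-- Profiles correspond to tables. -/
noncomputable def tableEquiv (σ : Equiv.Perm Candidate) : Profile ≃ (Fin 3 → Fin 3 → ℕ) :=
  ((ballotEquiv σ).symm.arrowCongr (Equiv.refl ℕ)).trans (Equiv.curry _ _ _)

theorem tableEquiv_apply (σ : Equiv.Perm Candidate) (P : Profile) :
    tableEquiv σ P = P.table σ := rfl

/-- Counting profiles row by row, for conditions that restrict the rows independently once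
the first-place votes are known. -/
theorem card_filter_table (σ : Equiv.Perm Candidate) {V : ℕ} {E : Profile → Prop}
    (R : (Fin 3 → ℕ) → Prop) (C : (Fin 3 → ℕ) → Fin 3 → (Fin 3 → ℕ) → Prop) [DecidablePred E]
    [DecidablePred R] [∀ x i, DecidablePred (C x i)]
    (hE : ∀ P ∈ profiles V, E P ↔ R (P.firsts σ) ∧ ∀ i, C (P.firsts σ) i (P.table σ i)) :
    ((profiles V).filter E).card =
      ∑ x ∈ (Finset.piAntidiag Finset.univ V).filter R,
        ∏ i, ((Finset.piAntidiag Finset.univ (x i)).filter (C x i)).card := by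
  have hmem : ∀ P : Profile, P ∈ profiles V ↔ ∑ b, P b = V := fun P => by simp [profiles]
  -- The fibre over a vector `x` of first-place votes is a product of three independent sets of rows
  -- with sums `x i`.
  rw [Finset.card_eq_sum_card_fiberwise (f := fun P : Profile => P.firsts σ)
    (t := (Finset.piAntidiag Finset.univ V).filter R)]
  · refine Finset.sum_congr rfl fun x hx => ?_
    rw [← Fintype.card_piFinset]
    refine Finset.card_equiv (tableEquiv σ) fun P => ?_
    simp only [Finset.mem_filter, Finset.mem_piAntidiag, Finset.mem_univ, implies_true,
      and_true] at hx
    simp only [Finset.mem_filter, Finset.mem_piAntidiag, Finset.mem_univ, implies_true,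
      and_true, Fintype.mem_piFinset, tableEquiv_apply]
    constructor
    · rintro ⟨⟨hP, hE'⟩, rfl⟩ i
      exact ⟨rfl, ((hE P hP).1 hE').2 i⟩
    · intro h
      have hx' : P.firsts σ = x := funext fun i => (h i).1
      have hP : P ∈ profiles V := by
        rw [hmem, ← Profile.sum_firsts σ P, hx']
        exact hx.1
      refine ⟨⟨hP, (hE P hP).2 ?_⟩, hx'⟩
      rw [hx']
      exact ⟨hx.2, fun i => (h i).2⟩
  · intro P hP
    simp only [Finset.coe_filter, Set.mem_ofPred_eq] at hP
    have h := ((hE P hP.1).1 hP.2).1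
    have hV := (hmem P).1 hP.1
    simp only [Finset.coe_filter, Finset.mem_piAntidiag, Finset.mem_univ, implies_true,
      and_true, Set.mem_ofPred_eq]
    exact ⟨by rw [← hV]; exact Profile.sum_firsts σ P, h⟩

/-- The number of rows with sum `n` whose second entry exceeds the third by at least `d`. -/
def rowCount (n d : ℕ) : ℕ :=
  ((Finset.piAntidiag (Finset.univ : Finset (Fin 3)) n).filter fun q => q 2 + d ≤ q 1).card

theorem sum_range_half (m : ℕ) :
    ∑ b ∈ Finset.range (m / 2 + 1), (m - 2 * b + 1) = (m + 2) ^ 2 / 4 := by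
  induction m using Nat.twoStepInduction with
  | zero => rfl
  | one => rfl
  | more n ih _ =>
    -- Passing from `n` to `n + 2` adds the term `n + 3` at `b = 0` and shifts the others; on the
    -- right, (n + 4)² = (n + 2)² + 4(n + 3).
    rw [show (n + 2) / 2 + 1 = n / 2 + 1 + 1 by omega, Finset.sum_range_succ']
    have h : ∀ b, n + 2 - 2 * (b + 1) + 1 = n - 2 * b + 1 := fun b => by omega
    simp only [h]
    rw [ih, show (n + 2 + 2) ^ 2 = (n + 2) ^ 2 + (n + 3) * 4 by ring,
      Nat.add_mul_div_right _ _ (by norm_num)]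
    omega

/-- Such a row is given by its smaller compared entry b and the surplus t of the difference over
`d`; the remaining entry m - 2b - t must be non-negative, which leaves m - 2b + 1 values of t. -/
theorem rowCount_add (m d : ℕ) : rowCount (m + d) d = (m + 2) ^ 2 / 4 := by
  rw [← sum_range_half, rowCount]
  have h : ∀ b, m - 2 * b + 1 = (Finset.range (m - 2 * b + 1)).card := by simp
  rw [Finset.sum_congr rfl fun b _ => h b, ← Finset.card_sigma]
  refine Finset.card_nbij' (fun q => ⟨q 2, q 1 - q 2 - d⟩)
    (fun y => ![m - 2 * y.1 - y.2, y.1 + d + y.2, y.1]) ?_ ?_ ?_ ?_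
  · intro q hq
    simp [Fin.sum_univ_three] at hq ⊢
    omega
  · rintro ⟨b, t⟩ hy
    simp [Fin.sum_univ_three] at hy ⊢
    omega
  · intro q hq
    simp [Fin.sum_univ_three] at hq ⊢
    ext i
    fin_cases i
    all_goals
      simp
      try omega
  · rintro ⟨b, t⟩ hy
    simp at hy ⊢
    omega

theorem rowCount_of_lt {n d : ℕ} (h : n < d) : rowCount n d = 0 := by
  rw [rowCount, Finset.card_eq_zero, Finset.filter_eq_empty_iff]
  intro q hq
  simp [Fin.sum_univ_three] at hq
  omega

theorem card_filter_exists_perm {V : ℕ} {F : Profile → Prop}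
    (E : Equiv.Perm Candidate → Profile → Prop) (N : ℕ) [DecidablePred F]
    [∀ σ, DecidablePred (E σ)] (hF : ∀ P, F P ↔ ∃ σ, E σ P)
    (hE : ∀ σ P, E σ P → P.RunnerUpWins σ)
    (hN : ∀ σ, ((profiles V).filter (E σ)).card = N) :
    ((profiles V).filter F).card = 6 * N := by
  have h : (profiles V).filter F = Finset.univ.biUnion fun σ => (profiles V).filter (E σ) := by
    ext P
    simp [hF]
  rw [h, Finset.card_biUnion]
  · simp [hN, Fintype.card_perm, Nat.factorial]
  · intro σ _ τ _ hne
    rw [Function.onFun, Finset.disjoint_left]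
    intro P h1 h2
    exact hne ((hE σ P (Finset.mem_filter.1 h1).2).unique (hE τ P (Finset.mem_filter.1 h2).2))

/-- The vectors of first-place votes for which the runner-up can win. -/
def runoffTotals (V : ℕ) : Finset (Fin 3 → ℕ) :=
  (Finset.piAntidiag Finset.univ V).filter fun x => x 2 < x 1 ∧ x 1 < x 0 ∧ x 0 < x 1 + x 2

open Classical in
theorem card_winnersDiffer (V : ℕ) :
    ((profiles V).filter Profile.WinnersDiffer).card =
      6 * ∑ x ∈ runoffTotals V, (x 0 + 2).choose 2 * (x 1 + 2).choose 2 *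
        rowCount (x 2) (x 0 - x 1 + 1) := by
  refine card_filter_exists_perm _ _ Profile.winnersDiffer_iff (fun _ _ h => h) fun σ => ?_
  rw [card_filter_table σ (fun x => x 2 < x 1 ∧ x 1 < x 0)
    (fun x i q => i = 2 → q 2 + (x 0 - x 1 + 1) ≤ q 1)]
  · symm
    have hsub : runoffTotals V ⊆
        (Finset.piAntidiag Finset.univ V).filter fun x => x 2 < x 1 ∧ x 1 < x 0 := by
      intro x
      simp only [runoffTotals, Finset.mem_filter]
      tauto
    refine (Finset.sum_congr rfl fun x _ => ?_).trans (Finset.sum_subset hsub ?_)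
    · simp [Fin.prod_univ_three, card_piAntidiag_fin_three, rowCount]
    · intro x hx hx'
      simp only [runoffTotals, Finset.mem_filter] at hx hx'
      -- The third inequality in `runoffTotals` costs nothing: where it fails, C's ballots cannot
      -- make up B's deficit against A.
      have : rowCount (x 2) (x 0 - x 1 + 1) = 0 := by
        apply rowCount_of_lt
        have : ¬ x 0 < x 1 + x 2 := fun h => hx' ⟨hx.1, hx.2.1, hx.2.2, h⟩
        omega
      rw [rowCount] at this
      simp [Fin.prod_univ_three, this]
  · intro P _
    simp only [Profile.RunnerUpWins, forall_eq]
    omega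

open Classical in
theorem card_negativeParticipationParadox (V : ℕ) :
    ((profiles V).filter Profile.NegativeParticipationParadox).card =
      6 * ∑ x ∈ runoffTotals V, (x 0 + 2).choose 2 *
        ((x 1 + 2).choose 2 - rowCount (x 1) (x 0 - x 1 - 1)) *
        rowCount (x 2) (x 0 - x 1 + 1) := by
  refine card_filter_exists_perm _ _ Profile.negativeParticipationParadox_iff
    (fun _ _ h => h.1) fun σ => ?_
  rw [card_filter_table σ (fun x => x 2 < x 1 ∧ x 1 < x 0)
    -- The condition on row 1 is written as a negation, so that its count is a complement and the
    -- required excess `x 0 - x 1 - 1` is a genuine non-negative difference.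
    (fun x i q => (i = 1 → ¬ q 2 + (x 0 - x 1 - 1) ≤ q 1) ∧
      (i = 2 → q 2 + (x 0 - x 1 + 1) ≤ q 1))]
  · symm
    have hsub : runoffTotals V ⊆
        (Finset.piAntidiag Finset.univ V).filter fun x => x 2 < x 1 ∧ x 1 < x 0 := by
      intro x
      simp only [runoffTotals, Finset.mem_filter]
      tauto
    have hcompl : ∀ n d : ℕ, ((Finset.piAntidiag (Finset.univ : Finset (Fin 3)) n).filter
        fun q => ¬ q 2 + d ≤ q 1).card = (n + 2).choose 2 - rowCount n d := by
      intro n d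
      rw [← card_piAntidiag_fin_three, rowCount, ← Finset.card_filter_add_card_filter_not
        (s := Finset.piAntidiag (Finset.univ : Finset (Fin 3)) n) fun q => q 2 + d ≤ q 1]
      simp
    refine (Finset.sum_congr rfl fun x _ => ?_).trans (Finset.sum_subset hsub ?_)
    · rw [← hcompl]
      simp [Fin.prod_univ_three, card_piAntidiag_fin_three, rowCount]
    · intro x hx hx'
      simp only [runoffTotals, Finset.mem_filter] at hx hx'
      have : rowCount (x 2) (x 0 - x 1 + 1) = 0 := by
        apply rowCount_of_lt
        have : ¬ x 0 < x 1 + x 2 := fun h => hx' ⟨hx.1, hx.2.1, hx.2.2, h⟩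
        omega
      rw [rowCount] at this
      simp [Fin.prod_univ_three, this]
  · intro P _
    simp only [Profile.RunnerUpWins, forall_and, forall_eq]
    omega

/-- The vectors of first-place votes without a majority. -/
def noMajorityTotals (V : ℕ) : Finset (Fin 3 → ℕ) :=
  (Finset.piAntidiag Finset.univ V).filter fun x => ∀ i, 2 * x i ≤ V

open Classical in
theorem card_noMajorityCandidate (V : ℕ) :
    ((profiles V).filter Profile.NoMajorityCandidate).card =
      ∑ x ∈ noMajorityTotals V,
        (x 0 + 2).choose 2 * (x 1 + 2).choose 2 * (x 2 + 2).choose 2 := by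
  rw [card_filter_table 1 (fun x => ∀ i, 2 * x i ≤ V) (fun _ _ _ => True)]
  · rw [noMajorityTotals]
    refine Finset.sum_congr rfl fun x _ => ?_
    simp [Fin.prod_univ_three, card_piAntidiag_fin_three]
  · intro P hP
    have hP : ∑ b, P b = V := by simpa [profiles] using hP
    simp [Profile.noMajorityCandidate_iff, hP]

/-! ### Riemann sums over lattice points of the simplex -/

theorem isBounded_of_subset_simplex {s : Set (Fin 2 → ℝ)}
    (hsub : ∀ p ∈ s, 0 ≤ p 0 ∧ 0 ≤ p 1 ∧ p 0 + p 1 ≤ 1) : Bornology.IsBounded s := by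
  refine (Metric.isBounded_Icc (0 : Fin 2 → ℝ) 1).subset fun p hp => ?_
  obtain ⟨h0, h1, h2⟩ := hsub p hp
  constructor <;> intro i <;> fin_cases i <;> simp <;> linarith

open MeasureTheory Pointwise in
/-- Riemann sums over the lattice points with coordinate sum `V` in a convex region of the simplex. -/
theorem tendsto_sum_piAntidiag {s : Set (Fin 2 → ℝ)} (hconv : Convex ℝ s) (hmeas : MeasurableSet s)
    (hsub : ∀ p ∈ s, 0 ≤ p 0 ∧ 0 ≤ p 1 ∧ p 0 + p 1 ≤ 1) {F : (Fin 2 → ℝ) → ℝ} (hF : Continuous F)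
    {T : ℕ → Finset (Fin 3 → ℕ)}
    (hT : ∀ V, 0 < V → ∀ x, x ∈ T V ↔ ∑ i, x i = V ∧ ![(x 0 : ℝ) / V, (x 1 : ℝ) / V] ∈ s) :
    Tendsto (fun V : ℕ => (∑ x ∈ T V, F ![(x 0 : ℝ) / V, (x 1 : ℝ) / V]) / (V : ℝ) ^ 2) atTop
      (𝓝 (∫ p in s, F p)) := by
  have hb := isBounded_of_subset_simplex hsub
  -- Convexity enters here only: the frontier of a convex set is null.
  have h := tendsto_tsum_div_pow_atTop_integral s F hF hb hmeas (hconv.addHaar_frontier volume)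
  rw [Fintype.card_fin] at h
  refine h.congr' ?_
  filter_upwards [eventually_gt_atTop 0] with V hV
  have hV' : (0 : ℝ) < V := by exact_mod_cast hV
  congr 1
  have hset : s ∩ (V : ℝ)⁻¹ • (Submodule.span ℤ (Set.range (Pi.basisFun ℝ (Fin 2))) :
      Set (Fin 2 → ℝ)) =
      ((T V).image fun x => ![(x 0 : ℝ) / V, (x 1 : ℝ) / V] : Finset (Fin 2 → ℝ)) := by
    have : NeZero V := ⟨hV.ne'⟩
    ext p
    simp only [Finset.coe_image, Set.mem_inter_iff, Set.mem_image, Finset.mem_coe]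
    have hm := BoxIntegral.unitPartition.mem_smul_span_iff (n := V) (v := p)
    constructor
    · rintro ⟨hp, hp'⟩
      obtain ⟨h0, h1, h2⟩ := hsub p hp
      have hp' := hm.1 hp'
      obtain ⟨a, ha⟩ := hp' 0
      obtain ⟨b, hb⟩ := hp' 1
      simp only [algebraMap_int_eq, eq_intCast] at ha hb
      have ha0 : 0 ≤ a := by
        have : (0 : ℝ) ≤ a := by rw [ha]; positivity
        exact_mod_cast this
      have hb0 : 0 ≤ b := by
        have : (0 : ℝ) ≤ b := by rw [hb]; positivity
        exact_mod_cast this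
      lift a to ℕ using ha0
      lift b to ℕ using hb0
      simp only [Int.cast_natCast] at ha hb
      have hab : a + b ≤ V := by
        have : (a : ℝ) + b ≤ V := by rw [ha, hb]; nlinarith
        exact_mod_cast this
      have hpe : ![(a : ℝ) / V, (b : ℝ) / V] = p := by
        ext i
        fin_cases i
        · simp only [ha]
          simp
          field_simp
        · simp only [hb]
          simp
          field_simp
      refine ⟨![a, b, V - a - b], (hT V hV _).2 ⟨?_, ?_⟩, ?_⟩
      · simp [Fin.sum_univ_three]
        omega
      · simpa [hpe] using hp
      · simpa using hpe
    · rintro ⟨x, hx, rfl⟩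
      refine ⟨((hT V hV x).1 hx).2, hm.2 fun i => ?_⟩
      fin_cases i
      · exact ⟨x 0, by simp; field_simp⟩
      · exact ⟨x 1, by simp; field_simp⟩
  rw [hset]
  rw [Finset.tsum_subtype' _ F, Finset.sum_image]
  -- Two shares determine the lattice point, because the third coordinate is `V` minus the other
  -- two.
  intro x hx y hy hxy
  have hx := ((hT V hV x).1 hx).1
  have hy := ((hT V hV y).1 hy).1
  have e0 := congrFun hxy 0
  have e1 := congrFun hxy 1
  simp [hV'.ne'] at e0 e1
  rw [Fin.sum_univ_three] at hx hy
  ext i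
  fin_cases i
  · exact e0
  · exact e1
  · simp
    omega

open MeasureTheory in
/-- Sums of functions that are asymptotically homogeneous of degree `6`. -/
theorem tendsto_sum_div_pow {s : Set (Fin 2 → ℝ)} (hconv : Convex ℝ s) (hmeas : MeasurableSet s)
    (hsub : ∀ p ∈ s, 0 ≤ p 0 ∧ 0 ≤ p 1 ∧ p 0 + p 1 ≤ 1) {F : (Fin 2 → ℝ) → ℝ} (hF : Continuous F)
    {T : ℕ → Finset (Fin 3 → ℕ)}
    (hT : ∀ V, 0 < V → ∀ x, x ∈ T V ↔ ∑ i, x i = V ∧ ![(x 0 : ℝ) / V, (x 1 : ℝ) / V] ∈ s)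
    {a : (Fin 3 → ℕ) → ℝ} {K : ℝ}
    (ha : ∀ V, 0 < V → ∀ x ∈ T V,
      |a x - (V : ℝ) ^ 6 * F ![(x 0 : ℝ) / V, (x 1 : ℝ) / V]| ≤ K * (V : ℝ) ^ 5) :
    Tendsto (fun V : ℕ => (∑ x ∈ T V, a x) / (V : ℝ) ^ 8) atTop (𝓝 (∫ p in s, F p)) := by
  have h := tendsto_sum_piAntidiag hconv hmeas hsub hF hT
  have hz : Tendsto (fun V : ℕ => (3 * |K|) / (V : ℝ)) atTop (𝓝 0) :=
    tendsto_const_div_atTop_nhds_zero_nat _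
  -- At most 3V² terms, each with error at most |K|V⁵, leave an error of at most 3|K|/V after
  -- division by V⁸.
  refine (tendsto_iff_of_dist (squeeze_zero' (Eventually.of_forall fun _ => dist_nonneg) ?_ hz)).1 h
  filter_upwards [eventually_gt_atTop 0] with V hV
  have hV' : (1 : ℝ) ≤ V := by exact_mod_cast hV
  have hcard : ((T V).card : ℝ) ≤ 3 * (V : ℝ) ^ 2 := by
    have h1 : (T V).card ≤ (V + 2).choose 2 := by
      rw [← card_piAntidiag_fin_three]
      refine Finset.card_le_card fun x hx => ?_
      simpa using ((hT V hV x).1 hx).1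
    have h2 : ((T V).card : ℝ) ≤ ((V + 2).choose 2 : ℕ) := by exact_mod_cast h1
    rw [Nat.cast_choose_two] at h2
    push_cast at h2
    nlinarith
  have hdiff : |∑ x ∈ T V, (a x - (V : ℝ) ^ 6 * F ![(x 0 : ℝ) / V, (x 1 : ℝ) / V])| ≤
      3 * (V : ℝ) ^ 2 * (|K| * (V : ℝ) ^ 5) := by
    refine (Finset.abs_sum_le_sum_abs _ _).trans ?_
    refine (Finset.sum_le_card_nsmul _ _ (|K| * (V : ℝ) ^ 5) fun x hx => ?_).trans ?_
    · exact (ha V hV x hx).trans (by gcongr; exact le_abs_self K)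
    · rw [nsmul_eq_mul]
      gcongr
  rw [dist_comm, Real.dist_eq]
  have he : (∑ x ∈ T V, a x) / (V : ℝ) ^ 8 -
      (∑ x ∈ T V, F ![(x 0 : ℝ) / V, (x 1 : ℝ) / V]) / (V : ℝ) ^ 2 =
      (∑ x ∈ T V, (a x - (V : ℝ) ^ 6 * F ![(x 0 : ℝ) / V, (x 1 : ℝ) / V])) / (V : ℝ) ^ 8 := by
    rw [Finset.sum_sub_distrib, ← Finset.mul_sum]
    field_simp
  rw [he, abs_div, abs_of_pos (by positivity : (0 : ℝ) < (V : ℝ) ^ 8),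
    div_le_div_iff₀ (by positivity) (by positivity)]
  calc _ ≤ 3 * (V : ℝ) ^ 2 * (|K| * (V : ℝ) ^ 5) * V := by gcongr
    _ = _ := by ring

/-! ### Evaluating the integrals -/

open MeasureTheory in
/-- Fubini's theorem for a region between two graphs in the coordinate plane; `J` stands for open
or closed intervals. -/
theorem setIntegral_fin_two {J : ℝ → ℝ → Set ℝ} (hJ : ∀ a b, J a b =ᵐ[volume] Set.Ioc a b)
    (hJm : ∀ a b, MeasurableSet (J a b)) {s : Set (Fin 2 → ℝ)} (hmeas : MeasurableSet s)
    (hb : Bornology.IsBounded s) {a b : ℝ} (hab : a ≤ b) {g h : ℝ → ℝ}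
    (hgh : ∀ x ∈ J a b, g x ≤ h x)
    (hmem : ∀ x y, ![x, y] ∈ s ↔ x ∈ J a b ∧ y ∈ J (g x) (h x)) {f : ℝ → ℝ → ℝ}
    (hf : Continuous fun p : Fin 2 → ℝ => f (p 0) (p 1)) :
    ∫ p in s, f (p 0) (p 1) = ∫ x in a..b, ∫ y in g x..h x, f x y := by
  have hint : Integrable (s.indicator fun p : Fin 2 → ℝ => f (p 0) (p 1)) := by
    rw [integrable_indicator_iff hmeas]
    exact (hf.continuousOn.integrableOn_compact hb.isCompact_closure).mono_set subset_closure
  have hmp := (volume_preserving_finTwoArrow ℝ).symm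
  rw [← integral_indicator hmeas, ← hmp.integral_comp' , Measure.volume_eq_prod, integral_prod]
  · have hin : ∀ x, ∫ y, s.indicator (fun p : Fin 2 → ℝ => f (p 0) (p 1))
        (MeasurableEquiv.finTwoArrow.symm (x, y)) =
        (J a b).indicator (fun x => ∫ y in g x..h x, f x y) x := by
      intro x
      by_cases hx : x ∈ J a b
      · rw [Set.indicator_of_mem hx, intervalIntegral.integral_of_le (hgh x hx),
          ← setIntegral_congr_set (hJ _ _), ← integral_indicator (hJm _ _)]
        refine integral_congr_ae (Eventually.of_forall fun y => ?_)
        change s.indicator (fun p : Fin 2 → ℝ => f (p 0) (p 1)) ![x, y] = _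
        by_cases hy : y ∈ J (g x) (h x)
        · rw [Set.indicator_of_mem ((hmem x y).2 ⟨hx, hy⟩), Set.indicator_of_mem hy]
          simp
        · rw [Set.indicator_of_notMem (fun hxy => hy ((hmem x y).1 hxy).2),
            Set.indicator_of_notMem hy]
      · rw [Set.indicator_of_notMem hx]
        refine integral_eq_zero_of_ae (Eventually.of_forall fun y => ?_)
        change s.indicator (fun p : Fin 2 → ℝ => f (p 0) (p 1)) ![x, y] = _
        rw [Set.indicator_of_notMem (fun hxy => hx ((hmem x y).1 hxy).1)]
        rfl
    simp_rw [hin]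
    rw [integral_indicator (hJm _ _), setIntegral_congr_set (hJ _ _),
      intervalIntegral.integral_of_le hab]
  · exact (hmp.integrable_comp_emb (MeasurableEquiv.measurableEmbedding _)).2 hint

theorem integral_poly (a b c0 c1 c2 c3 c4 c5 c6 c7 : ℝ) :
    ∫ x in a..b, (c0 + c1 * x + c2 * x ^ 2 + c3 * x ^ 3 + c4 * x ^ 4 + c5 * x ^ 5 + c6 * x ^ 6 +
      c7 * x ^ 7) = c0 * (b - a) + c1 / 2 * (b ^ 2 - a ^ 2) + c2 / 3 * (b ^ 3 - a ^ 3) +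
      c3 / 4 * (b ^ 4 - a ^ 4) + c4 / 5 * (b ^ 5 - a ^ 5) + c5 / 6 * (b ^ 6 - a ^ 6) +
      c6 / 7 * (b ^ 7 - a ^ 7) + c7 / 8 * (b ^ 8 - a ^ 8) := by
  have h : ∀ x ∈ Set.uIcc a b, HasDerivAt (fun x : ℝ => c0 * x + c1 / 2 * x ^ 2 + c2 / 3 * x ^ 3 +
      c3 / 4 * x ^ 4 + c4 / 5 * x ^ 5 + c5 / 6 * x ^ 6 + c6 / 7 * x ^ 7 + c7 / 8 * x ^ 8)
      (c0 + c1 * x + c2 * x ^ 2 + c3 * x ^ 3 + c4 * x ^ 4 + c5 * x ^ 5 + c6 * x ^ 6 +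
      c7 * x ^ 7) x := by
    intro x _
    have hp : ∀ n : ℕ, HasDerivAt (fun x : ℝ => x ^ n) (n * x ^ (n - 1)) x :=
      fun n => hasDerivAt_pow n x
    refine HasDerivAt.congr_deriv (((((((((hasDerivAt_id x).const_mul c0).add ((hp 2).const_mul (c1 / 2))).add
      ((hp 3).const_mul (c2 / 3))).add ((hp 4).const_mul (c3 / 4))).add
      ((hp 5).const_mul (c4 / 5))).add ((hp 6).const_mul (c5 / 6))).add
      ((hp 7).const_mul (c6 / 7))).add ((hp 8).const_mul (c7 / 8))) ?_
    push_cast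
    norm_num
    ring
  rw [intervalIntegral.integral_eq_sub_of_hasDerivAt h
    (Continuous.intervalIntegrable (by fun_prop) _ _)]
  ring

/-! ### Comparing row counts with their leading terms -/

theorem abs_choose_two_sub_le {n V : ℕ} (hn : n ≤ V) (hV : 0 < V) :
    |((n + 2).choose 2 : ℝ) - (n : ℝ) ^ 2 / 2| ≤ 3 * (V : ℝ) := by
  have hV' : (1 : ℝ) ≤ V := by exact_mod_cast hV
  have hn' : (n : ℝ) ≤ V := by exact_mod_cast hn
  have hn0 : (0 : ℝ) ≤ n := n.cast_nonneg
  rw [Nat.cast_choose_two, abs_le]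
  push_cast
  constructor <;> nlinarith

/-- The slack of 1 between `n - d` and `r` absorbs the shifts by 1 in the strict integer
inequalities; `r` is the homogeneous part that enters the integrand. -/
theorem abs_rowCount_sub_le {n d V : ℕ} {r : ℝ} (hd : d ≤ n) (hn : n ≤ V) (hV : 0 < V)
    (hr0 : 0 ≤ r) (hr : r ≤ V) (hnr : |(n : ℝ) - d - r| ≤ 1) :
    |(rowCount n d : ℝ) - r ^ 2 / 4| ≤ 3 * (V : ℝ) := by
  obtain ⟨m, rfl⟩ := Nat.exists_eq_add_of_le' hd
  have hV' : (1 : ℝ) ≤ V := by exact_mod_cast hV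
  have hn' : (m : ℝ) ≤ V := by exact_mod_cast (by omega : m ≤ V)
  push_cast at hnr
  rw [abs_le] at hnr
  obtain ⟨h1, h2⟩ := hnr
  rw [rowCount_add]
  have hq : (m + 2) ^ 2 / 4 * 4 ≤ (m + 2) ^ 2 ∧ (m + 2) ^ 2 ≤ (m + 2) ^ 2 / 4 * 4 + 4 := by
    omega
  have hq1 : (((m + 2) ^ 2 / 4 : ℕ) : ℝ) * 4 ≤ ((m : ℝ) + 2) ^ 2 := by exact_mod_cast hq.1
  have hq2 : ((m : ℝ) + 2) ^ 2 ≤ (((m + 2) ^ 2 / 4 : ℕ) : ℝ) * 4 + 4 := by exact_mod_cast hq.2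
  have hm0 : (0 : ℝ) ≤ m := m.cast_nonneg
  have h3 : ((m : ℝ) + 2) ^ 2 - r ^ 2 = (m + 2 - r) * (m + 2 + r) := by ring
  rw [abs_le]
  constructor
  · have : 0 ≤ ((m : ℝ) + 2 - r) * (m + 2 + r) := mul_nonneg (by linarith) (by linarith)
    linarith
  · have : ((m : ℝ) + 2 - r) * (m + 2 + r) ≤ 3 * (2 * V + 2) :=
      mul_le_mul (by linarith) (by linarith) (by linarith) (by norm_num)
    linarith

theorem rowCount_le_choose (n d : ℕ) : rowCount n d ≤ (n + 2).choose 2 := by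
  rw [← card_piAntidiag_fin_three]
  exact Finset.card_filter_le _ _

/-- The factors are replaced one at a time, each being at most 7V² in absolute value, so that 342 =
6·7·7 + 6·7 + 6. The allowance 6V, rather than 3V, is for a factor that is a difference of two
counts. -/
theorem abs_mul_mul_sub_le {V a b c a' b' c' : ℝ} (hV : 1 ≤ V) (ha : |a - a'| ≤ 6 * V)
    (hb : |b - b'| ≤ 6 * V) (hc : |c - c'| ≤ 6 * V) (ha' : |a'| ≤ V ^ 2) (hb' : |b'| ≤ V ^ 2)
    (hc' : |c'| ≤ V ^ 2) : |a * b * c - a' * b' * c'| ≤ 342 * V ^ 5 := by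
  have hVV : V ≤ V ^ 2 := by nlinarith
  have key : ∀ {u u' : ℝ}, |u - u'| ≤ 6 * V → |u'| ≤ V ^ 2 → |u| ≤ 7 * V ^ 2 := by
    intro u u' h h'
    have : |u| ≤ |u - u'| + |u'| := by simpa using abs_add_le (u - u') u'
    linarith
  have hb7 := key hb hb'
  have hc7 := key hc hc'
  calc |a * b * c - a' * b' * c'|
      = |(a - a') * b * c + a' * (b - b') * c + a' * b' * (c - c')| := by congr 1; ring
    _ ≤ |a - a'| * |b| * |c| + |a'| * |b - b'| * |c| + |a'| * |b'| * |c - c'| := by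
        refine (abs_add_three _ _ _).trans ?_
        simp only [abs_mul]
        rfl
    _ ≤ 6 * V * (7 * V ^ 2) * (7 * V ^ 2) + V ^ 2 * (6 * V) * (7 * V ^ 2) +
        V ^ 2 * V ^ 2 * (6 * V) := by gcongr
    _ = 342 * V ^ 5 := by ring

/-! ### The polygons of limiting shares -/

theorem convex_halfPlane_lt (c₀ c₁ r : ℝ) :
    Convex ℝ {p : Fin 2 → ℝ | c₀ * p 0 + c₁ * p 1 < r} :=
  convex_halfSpace_lt (f := fun p : Fin 2 → ℝ => c₀ * p 0 + c₁ * p 1)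
    ⟨fun x y => by simp; ring, fun c x => by simp; ring⟩ r

theorem convex_halfPlane_le (c₀ c₁ r : ℝ) :
    Convex ℝ {p : Fin 2 → ℝ | c₀ * p 0 + c₁ * p 1 ≤ r} :=
  convex_halfSpace_le (f := fun p : Fin 2 → ℝ => c₀ * p 0 + c₁ * p 1)
    ⟨fun x y => by simp; ring, fun c x => by simp; ring⟩ r

/-- The limiting shares of the first two candidates for which the runner-up can win. -/
def runoffRegion : Set (Fin 2 → ℝ) :=
  {p | p 1 < p 0 ∧ 1 < p 0 + 2 * p 1 ∧ p 0 < 1 / 2}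

/-- The limiting shares of the first two candidates without a majority. -/
def noMajorityRegion : Set (Fin 2 → ℝ) :=
  {p | p 0 ≤ 1 / 2 ∧ p 1 ≤ 1 / 2 ∧ 1 / 2 ≤ p 0 + p 1}

theorem convex_runoffRegion : Convex ℝ runoffRegion := by
  convert! ((convex_halfPlane_lt (-1) 1 0).inter (convex_halfPlane_lt (-1) (-2) (-1))).inter
    (convex_halfPlane_lt 1 0 (1 / 2)) using 1
  ext p
  simp only [runoffRegion, Set.mem_inter_iff, Set.mem_ofPred_eq, and_assoc]
  refine and_congr ?_ (and_congr ?_ ?_) <;> constructor <;> intro h <;> linarith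

theorem convex_noMajorityRegion : Convex ℝ noMajorityRegion := by
  convert! ((convex_halfPlane_le 1 0 (1 / 2)).inter (convex_halfPlane_le 0 1 (1 / 2))).inter
    (convex_halfPlane_le (-1) (-1) (-(1 / 2))) using 1
  ext p
  simp only [noMajorityRegion, Set.mem_inter_iff, Set.mem_ofPred_eq, and_assoc]
  refine and_congr ?_ (and_congr ?_ ?_) <;> constructor <;> intro h <;> linarith

theorem measurableSet_runoffRegion : MeasurableSet runoffRegion := by
  change MeasurableSet ({p : Fin 2 → ℝ | p 1 < p 0} ∩
    ({p : Fin 2 → ℝ | 1 < p 0 + 2 * p 1} ∩ {p : Fin 2 → ℝ | p 0 < 1 / 2}))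
  exact ((measurableSet_lt (by fun_prop) (by fun_prop)).inter
    ((measurableSet_lt (by fun_prop) (by fun_prop)).inter
      (measurableSet_lt (by fun_prop) (by fun_prop))))

theorem measurableSet_noMajorityRegion : MeasurableSet noMajorityRegion := by
  change MeasurableSet ({p : Fin 2 → ℝ | p 0 ≤ 1 / 2} ∩
    ({p : Fin 2 → ℝ | p 1 ≤ 1 / 2} ∩ {p : Fin 2 → ℝ | 1 / 2 ≤ p 0 + p 1}))
  exact ((measurableSet_le (by fun_prop) (by fun_prop)).inter
    ((measurableSet_le (by fun_prop) (by fun_prop)).inter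
      (measurableSet_le (by fun_prop) (by fun_prop))))

theorem runoffRegion_subset : ∀ p ∈ runoffRegion, 0 ≤ p 0 ∧ 0 ≤ p 1 ∧ p 0 + p 1 ≤ 1 := by
  rintro p ⟨h1, h2, h3⟩
  refine ⟨?_, ?_, ?_⟩ <;> linarith

theorem noMajorityRegion_subset :
    ∀ p ∈ noMajorityRegion, 0 ≤ p 0 ∧ 0 ≤ p 1 ∧ p 0 + p 1 ≤ 1 := by
  rintro p ⟨h1, h2, h3⟩
  refine ⟨?_, ?_, ?_⟩ <;> linarith

theorem mem_runoffTotals_iff {V : ℕ} (hV : 0 < V) (x : Fin 3 → ℕ) :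
    x ∈ runoffTotals V ↔ ∑ i, x i = V ∧ ![(x 0 : ℝ) / V, (x 1 : ℝ) / V] ∈ runoffRegion := by
  have hV' : (0 : ℝ) < V := by exact_mod_cast hV
  simp only [runoffTotals, runoffRegion, Finset.mem_filter, Finset.mem_piAntidiag,
    Finset.mem_univ, implies_true, and_true, Set.mem_ofPred_eq, Matrix.cons_val_zero,
    Matrix.cons_val_one, Fin.sum_univ_three]
  refine and_congr_right fun hx => ?_
  have hx' : (x 0 : ℝ) + x 1 + x 2 = V := by exact_mod_cast hx
  have e1 : (x 1 : ℝ) / V < x 0 / V ↔ x 1 < x 0 := by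
    rw [div_lt_div_iff_of_pos_right hV', Nat.cast_lt]
  have e2 : 1 < (x 0 : ℝ) / V + 2 * (x 1 / V) ↔ x 2 < x 1 := by
    rw [show (x 0 : ℝ) / V + 2 * (x 1 / V) = (x 0 + 2 * x 1) / V by ring, one_lt_div hV', ← hx']
    norm_cast
    omega
  have e3 : (x 0 : ℝ) / V < 1 / 2 ↔ x 0 < x 1 + x 2 := by
    rw [div_lt_div_iff₀ hV' two_pos, ← hx']
    norm_cast
    omega
  rw [e1, e2, e3]
  tauto

theorem mem_noMajorityTotals_iff {V : ℕ} (hV : 0 < V) (x : Fin 3 → ℕ) :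
    x ∈ noMajorityTotals V ↔
      ∑ i, x i = V ∧ ![(x 0 : ℝ) / V, (x 1 : ℝ) / V] ∈ noMajorityRegion := by
  have hV' : (0 : ℝ) < V := by exact_mod_cast hV
  simp only [noMajorityTotals, noMajorityRegion, Finset.mem_filter, Finset.mem_piAntidiag,
    Finset.mem_univ, implies_true, and_true, Set.mem_ofPred_eq, Matrix.cons_val_zero,
    Matrix.cons_val_one, Fin.sum_univ_three]
  refine and_congr_right fun hx => ?_
  have hx' : (x 0 : ℝ) + x 1 + x 2 = V := by exact_mod_cast hx
  have e1 : ∀ n : ℕ, (n : ℝ) / V ≤ 1 / 2 ↔ 2 * n ≤ V := fun n => by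
    rw [div_le_div_iff₀ hV' two_pos]
    norm_cast
    omega
  have e3 : 1 / 2 ≤ (x 0 : ℝ) / V + x 1 / V ↔ 2 * x 2 ≤ V := by
    rw [← add_div, div_le_div_iff₀ two_pos hV']
    norm_cast
    omega
  rw [e1, e1, e3]
  simp [Fin.forall_fin_succ]

/-! ### Asymptotics of the three counts -/

theorem tendsto_card_winnersDiffer :
    Tendsto (fun V : ℕ => ((∑ x ∈ runoffTotals V, (x 0 + 2).choose 2 * (x 1 + 2).choose 2 *
      rowCount (x 2) (x 0 - x 1 + 1) : ℕ) : ℝ) / (V : ℝ) ^ 8) atTop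
      (𝓝 (2431 / 5016453120)) := by
  -- With shares x, y, z of sum 1, the last factor is (z - (x - y))²/4 and z - x + y = 1 - 2x.
  let f : ℝ → ℝ → ℝ := fun x y => x ^ 2 / 2 * (y ^ 2 / 2) * ((1 - 2 * x) ^ 2 / 4)
  have hf : Continuous fun p : Fin 2 → ℝ => f (p 0) (p 1) := by
    unfold f
    fun_prop
  have hint : ∫ p in runoffRegion, f (p 0) (p 1) = 2431 / 5016453120 := by
    -- The inequalities y < x and 1 < x + 2y force x > 1/3, and y runs from (1 - x)/2 to x.
    rw [setIntegral_fin_two (J := Set.Ioo) (fun _ _ => MeasureTheory.Ioo_ae_eq_Ioc)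
      (fun _ _ => measurableSet_Ioo) measurableSet_runoffRegion
      (isBounded_of_subset_simplex runoffRegion_subset) (a := 1 / 3) (b := 1 / 2) (by norm_num)
      (g := fun x => (1 - x) / 2) (h := fun x => x) (fun x hx => by linarith [hx.1]) ?_ hf]
    · have hin : ∀ x : ℝ, ∫ y in (1 - x) / 2..x, f x y =
          0 + 0 * x + (-1 / 384) * x ^ 2 + 7 / 384 * x ^ 3 + (-19 / 384) * x ^ 4 +
            11 / 128 * x ^ 5 + (-1 / 8) * x ^ 6 + 3 / 32 * x ^ 7 := by
        intro x
        rw [show f x = fun y => 0 + 0 * y + (x ^ 2 * (1 - 2 * x) ^ 2 / 16) * y ^ 2 + 0 * y ^ 3 +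
          0 * y ^ 4 + 0 * y ^ 5 + 0 * y ^ 6 + 0 * y ^ 7 from funext fun y => by simp only [f]; ring,
          integral_poly]
        ring
      simp_rw [hin]
      rw [integral_poly]
      norm_num
    · intro x y
      simp only [runoffRegion, Set.mem_ofPred_eq, Matrix.cons_val_zero, Matrix.cons_val_one,
        Set.mem_Ioo]
      constructor
      · rintro ⟨h1, h2, h3⟩
        refine ⟨⟨?_, ?_⟩, ?_, ?_⟩ <;> linarith
      · rintro ⟨⟨h1, h2⟩, h3, h4⟩
        refine ⟨?_, ?_, ?_⟩ <;> linarith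
  rw [← hint]
  push_cast
  refine tendsto_sum_div_pow convex_runoffRegion measurableSet_runoffRegion runoffRegion_subset hf
    (fun V hV x => mem_runoffTotals_iff hV x) (K := 342) ?_
  intro V hV x hx
  have hV' : (1 : ℝ) ≤ V := by exact_mod_cast hV
  simp only [runoffTotals, Finset.mem_filter, Finset.mem_piAntidiag, Fin.sum_univ_three] at hx
  obtain ⟨⟨hsum, -⟩, h1, h2, h3⟩ := hx
  have hs : (x 0 : ℝ) + x 1 + x 2 = V := by exact_mod_cast hsum
  have hh3 : (x 0 : ℝ) < x 1 + x 2 := by exact_mod_cast h3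
  have p0 : (0 : ℝ) ≤ x 0 := Nat.cast_nonneg _
  have p1 : (0 : ℝ) ≤ x 1 := Nat.cast_nonneg _
  have p2 : (0 : ℝ) ≤ x 2 := Nat.cast_nonneg _
  have he : (V : ℝ) ^ 6 * f (x 0 / V) (x 1 / V) =
      (x 0 : ℝ) ^ 2 / 2 * ((x 1 : ℝ) ^ 2 / 2) * (((V : ℝ) - 2 * x 0) ^ 2 / 4) := by
    simp only [f]
    field_simp
  simp only [Matrix.cons_val_zero, Matrix.cons_val_one]
  rw [he]
  refine abs_mul_mul_sub_le hV' ?_ ?_ ?_ ?_ ?_ ?_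
  · exact (abs_choose_two_sub_le (by omega) hV).trans (by linarith)
  · exact (abs_choose_two_sub_le (by omega) hV).trans (by linarith)
  · refine (abs_rowCount_sub_le (V := V) (by omega) (by omega) hV (by linarith) (by linarith)
      ?_).trans (by linarith)
    push_cast [Nat.cast_sub h2.le]
    rw [abs_le]
    constructor <;> linarith
  · rw [abs_of_nonneg (by positivity)]
    nlinarith
  · rw [abs_of_nonneg (by positivity)]
    nlinarith
  · rw [abs_of_nonneg (by positivity)]
    nlinarith

theorem tendsto_card_negativeParticipationParadox :
    Tendsto (fun V : ℕ => ((∑ x ∈ runoffTotals V, (x 0 + 2).choose 2 *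
      ((x 1 + 2).choose 2 - rowCount (x 1) (x 0 - x 1 - 1)) *
      rowCount (x 2) (x 0 - x 1 + 1) : ℕ) : ℝ) / (V : ℝ) ^ 8) atTop
      (𝓝 (169 / 557383680)) := by
  -- The middle factor is the complement in row 1: all y²/2 minus the (y - (x - y))²/4 rows
  -- excluded. The base 2y - x is positive on the region, where x < 1/2 < 2y.
  let f : ℝ → ℝ → ℝ := fun x y =>
    x ^ 2 / 2 * (y ^ 2 / 2 - (2 * y - x) ^ 2 / 4) * ((1 - 2 * x) ^ 2 / 4)
  have hf : Continuous fun p : Fin 2 → ℝ => f (p 0) (p 1) := by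
    unfold f
    fun_prop
  have hint : ∫ p in runoffRegion, f (p 0) (p 1) = 169 / 557383680 := by
    rw [setIntegral_fin_two (J := Set.Ioo) (fun _ _ => MeasureTheory.Ioo_ae_eq_Ioc)
      (fun _ _ => measurableSet_Ioo) measurableSet_runoffRegion
      (isBounded_of_subset_simplex runoffRegion_subset) (a := 1 / 3) (b := 1 / 2) (by norm_num)
      (g := fun x => (1 - x) / 2) (h := fun x => x) (fun x hx => by linarith [hx.1]) ?_ hf]
    · have hin : ∀ x : ℝ, ∫ y in (1 - x) / 2..x, f x y =
          0 + 0 * x + 1 / 384 * x ^ 2 + (-13 / 384) * x ^ 3 + 61 / 384 * x ^ 4 +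
            (-43 / 128) * x ^ 5 + 5 / 16 * x ^ 6 + (-3 / 32) * x ^ 7 := by
        intro x
        rw [show f x = fun y => -(x ^ 4 * (1 - 2 * x) ^ 2 / 32) +
          (x ^ 3 * (1 - 2 * x) ^ 2 / 8) * y + -(x ^ 2 * (1 - 2 * x) ^ 2 / 16) * y ^ 2 + 0 * y ^ 3 +
          0 * y ^ 4 + 0 * y ^ 5 + 0 * y ^ 6 + 0 * y ^ 7 from funext fun y => by simp only [f]; ring,
          integral_poly]
        ring
      simp_rw [hin]
      rw [integral_poly]
      norm_num
    · intro x y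
      simp only [runoffRegion, Set.mem_ofPred_eq, Matrix.cons_val_zero, Matrix.cons_val_one,
        Set.mem_Ioo]
      constructor
      · rintro ⟨h1, h2, h3⟩
        refine ⟨⟨?_, ?_⟩, ?_, ?_⟩ <;> linarith
      · rintro ⟨⟨h1, h2⟩, h3, h4⟩
        refine ⟨?_, ?_, ?_⟩ <;> linarith
  rw [← hint]
  -- The bound makes the truncated subtraction of counts a genuine one, so that the cast passes
  -- through it.
  push_cast [rowCount_le_choose]
  refine tendsto_sum_div_pow convex_runoffRegion measurableSet_runoffRegion runoffRegion_subset hf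
    (fun V hV x => mem_runoffTotals_iff hV x) (K := 342) ?_
  intro V hV x hx
  have hV' : (1 : ℝ) ≤ V := by exact_mod_cast hV
  simp only [runoffTotals, Finset.mem_filter, Finset.mem_piAntidiag, Fin.sum_univ_three] at hx
  obtain ⟨⟨hsum, -⟩, h1, h2, h3⟩ := hx
  have hs : (x 0 : ℝ) + x 1 + x 2 = V := by exact_mod_cast hsum
  have hh1 : (x 2 : ℝ) < x 1 := by exact_mod_cast h1
  have hh2 : (x 1 : ℝ) < x 0 := by exact_mod_cast h2
  have hh3 : (x 0 : ℝ) < x 1 + x 2 := by exact_mod_cast h3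
  have p0 : (0 : ℝ) ≤ x 0 := Nat.cast_nonneg _
  have p1 : (0 : ℝ) ≤ x 1 := Nat.cast_nonneg _
  have p2 : (0 : ℝ) ≤ x 2 := Nat.cast_nonneg _
  have he : (V : ℝ) ^ 6 * f (x 0 / V) (x 1 / V) =
      (x 0 : ℝ) ^ 2 / 2 * ((x 1 : ℝ) ^ 2 / 2 - (2 * x 1 - x 0) ^ 2 / 4) *
        (((V : ℝ) - 2 * x 0) ^ 2 / 4) := by
    simp only [f]
    field_simp
  simp only [Matrix.cons_val_zero, Matrix.cons_val_one]
  rw [he]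
  refine abs_mul_mul_sub_le hV' ?_ ?_ ?_ ?_ ?_ ?_
  · exact (abs_choose_two_sub_le (by omega) hV).trans (by linarith)
  · have b1 := abs_choose_two_sub_le (n := x 1) (V := V) (by omega) hV
    have b2 := abs_rowCount_sub_le (n := x 1) (d := x 0 - x 1 - 1) (V := V)
      (r := 2 * x 1 - x 0) (by omega) (by omega) hV (by linarith) (by linarith) (by
        rw [Nat.sub_sub, Nat.cast_sub h2, abs_le]
        push_cast
        constructor <;> linarith)
    rw [abs_le] at b1 b2 ⊢
    constructor <;> linarith [b1.1, b1.2, b2.1, b2.2]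
  · refine (abs_rowCount_sub_le (V := V) (by omega) (by omega) hV (by linarith) (by linarith)
      ?_).trans (by linarith)
    push_cast [Nat.cast_sub h2.le]
    rw [abs_le]
    constructor <;> linarith
  · rw [abs_of_nonneg (by positivity)]
    nlinarith
  · have s1 : (x 1 : ℝ) ^ 2 ≤ V ^ 2 := by gcongr; linarith
    have s2 : (2 * (x 1 : ℝ) - x 0) ^ 2 ≤ V ^ 2 := by
      have : (0 : ℝ) ≤ 2 * x 1 - x 0 := by linarith
      gcongr
      linarith
    rw [abs_le]
    constructor <;> nlinarith [sq_nonneg (x 1 : ℝ), sq_nonneg (2 * (x 1 : ℝ) - x 0)]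
  · rw [abs_of_nonneg (by positivity)]
    nlinarith

theorem tendsto_card_noMajorityCandidate :
    Tendsto (fun V : ℕ => ((∑ x ∈ noMajorityTotals V,
      (x 0 + 2).choose 2 * (x 1 + 2).choose 2 * (x 2 + 2).choose 2 : ℕ) : ℝ) / (V : ℝ) ^ 8) atTop
      (𝓝 (29 / 2064384)) := by
  let f : ℝ → ℝ → ℝ := fun x y => x ^ 2 / 2 * (y ^ 2 / 2) * ((1 - x - y) ^ 2 / 2)
  have hf : Continuous fun p : Fin 2 → ℝ => f (p 0) (p 1) := by
    unfold f
    fun_prop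
  have hint : ∫ p in noMajorityRegion, f (p 0) (p 1) = 29 / 2064384 := by
    rw [setIntegral_fin_two (J := Set.Icc) (fun _ _ => MeasureTheory.Ioc_ae_eq_Icc.symm)
      (fun _ _ => measurableSet_Icc) measurableSet_noMajorityRegion
      (isBounded_of_subset_simplex noMajorityRegion_subset) (a := 0) (b := 1 / 2) (by norm_num)
      (g := fun x => 1 / 2 - x) (h := fun _ => 1 / 2) (fun x hx => by linarith [hx.1]) ?_ hf]
    · have hin : ∀ x : ℝ, ∫ y in 1 / 2 - x..1 / 2, f x y =
          0 + 0 * x + 0 * x ^ 2 + 1 / 128 * x ^ 3 + (-1 / 32) * x ^ 4 +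
            1 / 24 * x ^ 5 + (-1 / 48) * x ^ 6 + 1 / 240 * x ^ 7 := by
        intro x
        rw [show f x = fun y => 0 + 0 * y + (x ^ 2 * (1 - x) ^ 2 / 8) * y ^ 2 +
          -(x ^ 2 * (1 - x) / 4) * y ^ 3 + (x ^ 2 / 8) * y ^ 4 + 0 * y ^ 5 + 0 * y ^ 6 +
          0 * y ^ 7 from funext fun y => by simp only [f]; ring, integral_poly]
        ring
      simp_rw [hin]
      rw [integral_poly]
      norm_num
    · intro x y
      simp only [noMajorityRegion, Set.mem_ofPred_eq, Matrix.cons_val_zero, Matrix.cons_val_one,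
        Set.mem_Icc]
      constructor
      · rintro ⟨h1, h2, h3⟩
        refine ⟨⟨?_, ?_⟩, ?_, ?_⟩ <;> linarith
      · rintro ⟨⟨h1, h2⟩, h3, h4⟩
        refine ⟨?_, ?_, ?_⟩ <;> linarith
  rw [← hint]
  push_cast
  refine tendsto_sum_div_pow convex_noMajorityRegion measurableSet_noMajorityRegion
    noMajorityRegion_subset hf (fun V hV x => mem_noMajorityTotals_iff hV x) (K := 342) ?_
  intro V hV x hx
  have hV' : (1 : ℝ) ≤ V := by exact_mod_cast hV
  simp only [noMajorityTotals, Finset.mem_filter, Finset.mem_piAntidiag,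
    Fin.sum_univ_three] at hx
  obtain ⟨⟨hsum, -⟩, -⟩ := hx
  have hs : (x 0 : ℝ) + x 1 + x 2 = V := by exact_mod_cast hsum
  have p0 : (0 : ℝ) ≤ x 0 := Nat.cast_nonneg _
  have p1 : (0 : ℝ) ≤ x 1 := Nat.cast_nonneg _
  have p2 : (0 : ℝ) ≤ x 2 := Nat.cast_nonneg _
  have he : (V : ℝ) ^ 6 * f (x 0 / V) (x 1 / V) =
      (x 0 : ℝ) ^ 2 / 2 * ((x 1 : ℝ) ^ 2 / 2) * ((x 2 : ℝ) ^ 2 / 2) := by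
    rw [show (x 2 : ℝ) = V - x 0 - x 1 by linarith]
    simp only [f]
    field_simp
  simp only [Matrix.cons_val_zero, Matrix.cons_val_one]
  rw [he]
  refine abs_mul_mul_sub_le hV' ?_ ?_ ?_ ?_ ?_ ?_
  · exact (abs_choose_two_sub_le (by omega) hV).trans (by linarith)
  · exact (abs_choose_two_sub_le (by omega) hV).trans (by linarith)
  · exact (abs_choose_two_sub_le (by omega) hV).trans (by linarith)
  · rw [abs_of_nonneg (by positivity)]
    nlinarith
  · rw [abs_of_nonneg (by positivity)]
    nlinarith
  · rw [abs_of_nonneg (by positivity)]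
    nlinarith

/-! ### Limits of the probabilities -/

theorem tendsto_card_profiles :
    Tendsto (fun V : ℕ => ((profiles V).card : ℝ) / (V : ℝ) ^ 8) atTop (𝓝 (1 / 40320)) := by
  -- The binomial coefficient (V + 8 choose 8) is asymptotic to (V + 8)⁸/8!, with 8! = 40320; `h1`
  -- then replaces V + 8 by V.
  have h := (isEquivalent_choose 8).comp_tendsto (tendsto_add_atTop_nat 8)
  have h1 : Tendsto (fun V : ℕ => ((V + 8 : ℕ) : ℝ) / V) atTop (𝓝 1) := by
    have := (tendsto_const_nhds (x := (1 : ℝ))).add (tendsto_const_div_atTop_nhds_zero_nat (8 : ℝ))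
    rw [add_zero] at this
    refine this.congr' ?_
    filter_upwards [eventually_gt_atTop 0] with V hV
    have : (V : ℝ) ≠ 0 := by exact_mod_cast hV.ne'
    push_cast
    field_simp
  have h2 := (Asymptotics.isEquivalent_iff_tendsto_one (Eventually.of_forall fun V => by
    simp only [Function.comp]; positivity)).1 h
  have h3 := (h2.mul (h1.pow 8)).mul_const (1 / 40320)
  simp only [one_pow, one_mul] at h3
  refine h3.congr' ?_
  filter_upwards [eventually_gt_atTop 0] with V hV
  have : (V : ℝ) ≠ 0 := by exact_mod_cast hV.ne'
  have : ((V + 8 : ℕ) : ℝ) ≠ 0 := by positivity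
  rw [card_profiles]
  simp only [Function.comp, Pi.div_apply, Nat.factorial]
  field_simp
  norm_num

open Classical in
theorem tendsto_iacProb {E : Profile → Prop} {c : ℝ}
    (h : Tendsto (fun V : ℕ => (((profiles V).filter E).card : ℝ) / (V : ℝ) ^ 8) atTop (𝓝 c)) :
    Tendsto (fun V => iacProb V E) atTop (𝓝 (40320 * c)) := by
  have h1 := h.div tendsto_card_profiles (by norm_num)
  rw [show c / (1 / 40320) = 40320 * c by ring] at h1
  refine h1.congr' ?_
  filter_upwards [eventually_gt_atTop 0] with V hV
  have : (V : ℝ) ≠ 0 := by exact_mod_cast hV.ne'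
  simp only [Pi.div_apply, iacProb]
  rw [div_div_div_cancel_right₀ (by positivity)]

theorem tendsto_iacCondProb {E F : Profile → Prop} (hEF : ∀ P, E P → F P) {c d : ℝ} (hd : d ≠ 0)
    (hE : Tendsto (fun V => iacProb V E) atTop (𝓝 c))
    (hF : Tendsto (fun V => iacProb V F) atTop (𝓝 d)) :
    Tendsto (fun V => iacCondProb V E F) atTop (𝓝 (c / d)) := by
  have h : (fun P => E P ∧ F P) = E := funext fun P => propext ⟨And.left, fun h => ⟨h, hEF P h⟩⟩
  simp only [iacCondProb, h]
  exact hE.div hF hd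

theorem tendsto_iacProb_negativeParticipationParadox :
    Tendsto (fun V => iacProb V Profile.NegativeParticipationParadox) atTop
      (𝓝 (169 / 2304)) := by
  convert tendsto_iacProb (c := 6 * (169 / 557383680)) ?_ using 2
  · norm_num
  · simp_rw [card_negativeParticipationParadox, Nat.cast_mul, mul_div_assoc]
    exact tendsto_card_negativeParticipationParadox.const_mul _

theorem tendsto_iacProb_winnersDiffer :
    Tendsto (fun V => iacProb V Profile.WinnersDiffer) atTop (𝓝 (2431 / 20736)) := by
  convert tendsto_iacProb (c := 6 * (2431 / 5016453120)) ?_ using 2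
  · norm_num
  · simp_rw [card_winnersDiffer, Nat.cast_mul, mul_div_assoc]
    exact tendsto_card_winnersDiffer.const_mul _

theorem tendsto_iacProb_noMajorityCandidate :
    Tendsto (fun V => iacProb V Profile.NoMajorityCandidate) atTop (𝓝 (145 / 256)) := by
  convert tendsto_iacProb (c := 29 / 2064384) ?_ using 2
  · norm_num
  · simp_rw [card_noMajorityCandidate]
    exact tendsto_card_noMajorityCandidate

theorem proposition2 :
    Tendsto (fun V : ℕ => iacProb V Profile.NegativeParticipationParadox)
        atTop (𝓝 (169 / 2304)) ∧
      Tendsto (fun V : ℕ => iacCondProb V Profile.NegativeParticipationParadox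
        Profile.NoMajorityCandidate) atTop (𝓝 (169 / 1305)) ∧
      Tendsto (fun V : ℕ => iacCondProb V Profile.NegativeParticipationParadox
        Profile.WinnersDiffer) atTop (𝓝 (117 / 187)) := by
  refine ⟨tendsto_iacProb_negativeParticipationParadox, ?_, ?_⟩
  · convert tendsto_iacCondProb (fun P h => h.noMajorityCandidate) (by norm_num)
      tendsto_iacProb_negativeParticipationParadox tendsto_iacProb_noMajorityCandidate using 2
    norm_num
  · convert tendsto_iacCondProb (fun P h => h.winnersDiffer) (by norm_num)
      tendsto_iacProb_negativeParticipationParadox tendsto_iacProb_winnersDiffer using 2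
    norm_num
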